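/- For an infinite binary sequence $x=x_0x_1x_2\dots\in\{0,1\}^{\mathbb N}$, integers $l\ge 1$ and $n\ge l$, and a word $w\in\{0,1\}^l$, let $$P(x_0^{n-1},w)=\frac{|\{\,0\le i\le n-l : x_i x_{i+1}\cdots x_{i+l-1}=w\,\}|}{n-l+1},\qquad H_l(x_0^{n-1})=-\frac1l\sum_{w\in\{0,1\}^l}P(x_0^{n-1},w)\log_2 P(x_0^{n-1},w),$$ with $0\log_2 0=0$. The finite-state dimension and the finite-state strong dimension of $x$ are $$\dim_{FS}(x)=\inf_{l\ge1}\liminf_{n\to\infty}H_l(x_0^{n-1}),\qquad \mathrm{Dim}_{FS}(x)=\inf_{l\ge1}\limsup_{n\to\infty}H_l(x_0^{n-1}).$$ Let $T$ be the left shift, $T(x_0x_1x_2\dots)=x_1x_2x_3\dots$, and let $v(x)=\sum_{i\ge0}x_i2^{-(i+1)} \bmod 1\in[0,1)$. Theorem. For every rational number $p/q\in(0,1)$ there is a sequence $x\in\{0,1\}^{\mathbb N}$ with $\dim_{FS}(x)=\mathrm{Dim}_{FS}(x)=p/q$ such that for some $k\in\mathbb Z$ the sequence of Weyl averages $$\Big\langle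 \frac1n\sum_{j=0}^{n-1}e^{2\pi i k\,v(T^jx)}\Big\rangle_{n=1}^{\infty}$$ does not converge. In particular (take $p/q=1/2$), the equality $\dim_{FS}(x)=\mathrm{Dim}_{FS}(x)$ does not force the Weyl averages of $x$ to converge. -/

import Mathlib

open Filter Topology

namespace FSDim

/-- Infinite binary sequences `x = x₀x₁x₂…` -/
abbrev BinSeq : Type := ℕ → Fin 2

/-- The left shift `T(x₀x₁x₂…) = x₁x₂x₃…`. -/
def shift (x : BinSeq) : BinSeq := fun n => x (n + 1)

/-- The evaluation map: the value `∑ xᵢ / 2^(i+1) mod 1` in `[0,1)`. -/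
noncomputable def value (x : BinSeq) : ℝ :=
  Int.fract (∑' i : ℕ, ((x i : ℕ) : ℝ) / 2 ^ (i + 1))

/-- The number of positions `i ∈ [0, n - l]` with `xᵢ … xᵢ₊ₗ₋₁ = w`, where `l = |w|`
(there are no such positions if `n < l`). -/
def slidingCount (x : BinSeq) (n : ℕ) {l : ℕ} (w : Fin l → Fin 2) : ℕ :=
  ((Finset.range (n + 1 - l)).filter fun i => ∀ t : Fin l, x (i + t) = w t).card

/-- The sliding count probability `P(x₀…xₙ₋₁, w)`; by convention it is `0` if `n < |w|`. -/
noncomputable def slidingProb (x : BinSeq) (n : ℕ) {l : ℕ} (w : Fin l → Fin 2) : ℝ :=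
  (slidingCount x n w : ℝ) / ((n + 1 - l : ℕ) : ℝ)

/-- The sliding block entropy `H_l(x₀…xₙ₋₁)`, with logarithms to base 2 and `0 log 0 = 0`. -/
noncomputable def slidingEntropy (x : BinSeq) (l n : ℕ) : ℝ :=
  -(1 / (l : ℝ)) * ∑ w : Fin l → Fin 2, slidingProb x n w * Real.logb 2 (slidingProb x n w)

/-- The finite-state dimension, the infimum being over block lengths `l ≥ 1`.
For each fixed `l` the entropies are bounded uniformly in `x` and `n`. -/
noncomputable def dimFS (x : BinSeq) : ℝ :=
  ⨅ l : ℕ+, liminf (fun n : ℕ => slidingEntropy x l n) atTop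

/-- The finite-state strong dimension, the infimum being over block lengths `l ≥ 1`. -/
noncomputable def strongDimFS (x : BinSeq) : ℝ :=
  ⨅ l : ℕ+, limsup (fun n : ℕ => slidingEntropy x l n) atTop

/-- The Weyl average `n⁻¹ ∑_{j < n} exp(2πik v(Tʲx))`. -/
noncomputable def weylAverage (x : BinSeq) (k : ℤ) (n : ℕ) : ℂ :=
  (∑ j ∈ Finset.range n,
    Complex.exp (2 * (Real.pi : ℂ) * Complex.I * (k : ℂ) * (value (shift^[j] x) : ℂ))) / (n : ℂ)

end FSDim

namespace FSDim

/-! Write r = p/q with p ≥ 2. Let x read a generic (coin-tossing) sequence z at residues below p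
modulo q, and at the other residues the slow sequence `dyadicPhase`, whose value alternates from one
interval [2^k, 2^(k+1)) to the next.

Dimension: a window of length l has on average lp/q letters from z, asymptotically uniform and
independent, so block entropies are asymptotically at least p/q whatever the other letters are
(`IsGeneric.le_dimFS_interleave`). Conversely `dyadicPhase` has only linearly many words of each
length, so for l = qk there are at most a polynomial factor times 2^(kp) words, and counting gives
p/q from above (`strongDimFS_interleave_le`).

Weyl averages: take k = 1 and the imaginary part sin(2πv). Positions whose leading digit comes from
z average to zero, since flipping that digit changes the sign. At the others the sign is that of the
current phase: the mean over a 0-phase tends to at least 1/(8q), and over a 1-phase to at most 0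
(`le_phaseMean_zero`, `phaseMean_one_nonpos`). A phase is as long as everything before it, so
convergent averages would force the same mean on both kinds of phase. -/

/-- Words of length `l` occur in `z` along every progression of step at least `l` with their
expected frequency. -/
def IsGeneric (z : BinSeq) : Prop :=
  ∀ l Q : ℕ, l ≤ Q → 0 < Q → ∀ (s : ℕ) (u : Fin l → Fin 2),
    Tendsto (fun K : ℕ => (∑ k ∈ Finset.range K,
      if ∀ t : Fin l, z (Q * k + s + t) = u t then (1 : ℝ) else 0) / K) atTop
      (𝓝 ((1 / 2) ^ l))

/-! ### Existence of generic sequences, by the strong law of large numbers -/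

section CoinTossing

open MeasureTheory ProbabilityTheory Function

/-- The fair coin measure on `Fin 2`. -/
noncomputable def coin : Measure (Fin 2) := (PMF.uniformOfFintype (Fin 2)).toMeasure

instance : IsProbabilityMeasure coin := by unfold coin; infer_instance

lemma coin_singleton (a : Fin 2) : coin {a} = 2⁻¹ := by
  simp [coin]

/-- Along an arithmetic progression whose step is at least the window length, almost every
sequence of fair coin tosses shows each word with its expected frequency. -/
lemma ae_tendsto_window_frequency {l Q : ℕ} (hlQ : l ≤ Q) (s : ℕ)
    (u : Fin l → Fin 2) :
    ∀ᵐ z : BinSeq ∂(Measure.infinitePi fun _ => coin),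
      Tendsto (fun K : ℕ => (∑ k ∈ Finset.range K,
        if ∀ t : Fin l, z (Q * k + s + t) = u t then (1 : ℝ) else 0) / K) atTop
        (𝓝 ((1 / 2) ^ l)) := by
  classical
  set μ : Measure BinSeq := Measure.infinitePi fun _ => coin with hμ
  let φ : (Fin l → Fin 2) → ℝ := fun w => if w = u then 1 else 0
  let W : ℕ → BinSeq → (Fin l → Fin 2) := fun k z t => z (Q * k + s + t)
  have hφ : Measurable φ := measurable_of_finite _
  have hW (k : ℕ) : Measurable (W k) := by fun_prop
  have hlaw (k : ℕ) : μ.map (W k) = Measure.infinitePi fun _ : Fin l => coin := by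
    have hinj : Function.Injective fun t : Fin l => Q * k + s + (t : ℕ) := by
      intro a b hab
      exact Fin.ext (by simpa using hab)
    exact Measure.map_infinitePi_infinitePi_of_inj (P := fun _ : ℕ => coin) hinj
  have hident (k : ℕ) : IdentDistrib (fun z => φ (W k z)) (fun z => φ (W 0 z)) μ μ :=
    (⟨(hW k).aemeasurable, (hW 0).aemeasurable, by rw [hlaw, hlaw]⟩ :
      IdentDistrib (W k) (W 0) μ μ).comp hφ
  have hindep : Pairwise ((· ⟂ᵢ[μ] ·) on fun k z => φ (W k z)) := by
    intro i j hij
    have hI : iIndepFun (fun (n : ℕ) (z : BinSeq) => z n) μ :=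
      iIndepFun_infinitePi (X := fun _ a => a) (by fun_prop)
    let S : ℕ → Finset ℕ := fun k => Finset.Ico (Q * k + s) (Q * k + s + l)
    -- This is where l ≤ Q is needed: windows along the progression do not overlap.
    have hdisj : Disjoint (S i) (S j) := by
      rw [Finset.disjoint_left]
      intro a ha hb
      simp only [S, Finset.mem_Ico] at ha hb
      rcases Nat.lt_or_gt_of_ne hij with h | h
      · have := Nat.mul_le_mul_left Q (Nat.succ_le_of_lt h)
        rw [Nat.mul_succ] at this
        omega
      · have := Nat.mul_le_mul_left Q (Nat.succ_le_of_lt h)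
        rw [Nat.mul_succ] at this
        omega
    have hmem (k : ℕ) (t : Fin l) : Q * k + s + t ∈ S k := by
      simp only [S, Finset.mem_Ico]
      omega
    have h := hI.indepFun_finset (S i) (S j) hdisj (fun n => measurable_pi_apply n)
    exact h.comp (φ := fun v => φ fun t => v ⟨_, hmem i t⟩)
      (ψ := fun v => φ fun t => v ⟨_, hmem j t⟩) (measurable_of_finite _) (measurable_of_finite _)
  have hint : Integrable (fun z => φ (W 0 z)) μ := by
    refine Integrable.of_bound (hφ.comp (hW 0)).aestronglyMeasurable 1 (ae_of_all _ fun z => ?_)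
    simp only [φ]
    split_ifs <;> simp
  have hmean : ∫ z, φ (W 0 z) ∂μ = (1 / 2) ^ l := by
    rw [← integral_map (hW 0).aemeasurable hφ.aestronglyMeasurable, hlaw]
    have : φ = Set.indicator {u} fun _ => (1 : ℝ) := by
      ext w
      simp [φ, Set.indicator_apply]
    rw [this, integral_indicator_const _ (measurableSet_singleton u), Measure.real,
      Measure.infinitePi_singleton_of_fintype]
    simp [coin_singleton]
  have h := strong_law_ae_real (μ := μ) (fun k z => φ (W k z)) hint hindep hident
  simp only [hmean] at h
  filter_upwards [h] with z hz
  simpa only [φ, W, funext_iff] using hz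

/-- Almost every sequence of fair coin tosses is generic. -/
lemma exists_isGeneric : ∃ z : BinSeq, IsGeneric z := by
  have h : ∀ᵐ z : BinSeq ∂(Measure.infinitePi fun _ => coin), IsGeneric z := by
    simp only [IsGeneric, ae_all_iff]
    intro l Q hlQ _ s u
    exact ae_tendsto_window_frequency hlQ s u
  exact h.exists

end CoinTossing

/-! ### Averages along generic sequences -/

/-- Splitting a sum over `range (Q * K)` into residue classes modulo `Q`. -/
lemma sum_range_mul_eq (Q K : ℕ) (h : ℕ → ℝ) :
    ∑ i ∈ Finset.range (Q * K), h i =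
      ∑ s ∈ Finset.range Q, ∑ k ∈ Finset.range K, h (Q * k + s) := by
  induction K with
  | zero => simp
  | succ K ih =>
    rw [Nat.mul_succ, Finset.sum_range_add, ih, ← Finset.sum_add_distrib]
    exact Finset.sum_congr rfl fun s _ => by rw [Finset.sum_range_succ]

/-- If a bounded sequence has an average along each residue class modulo `Q`, then it has an
average, the mean of those. -/
lemma tendsto_average_of_residues {Q : ℕ} (hQ : 0 < Q) {h : ℕ → ℝ} {C : ℝ}
    (hC : ∀ i, |h i| ≤ C) {a : ℕ → ℝ}
    (ha : ∀ s < Q, Tendsto (fun K : ℕ => (∑ k ∈ Finset.range K, h (Q * k + s)) / K) atTop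
      (𝓝 (a s))) :
    Tendsto (fun N : ℕ => (∑ i ∈ Finset.range N, h i) / N) atTop
      (𝓝 ((∑ s ∈ Finset.range Q, a s) / Q)) := by
  have hQ' : (0 : ℝ) < Q := by exact_mod_cast hQ
  have h1 : Tendsto (fun K : ℕ => (∑ i ∈ Finset.range (Q * K), h i) / K) atTop
      (𝓝 (∑ s ∈ Finset.range Q, a s)) := by
    have := tendsto_finsetSum (Finset.range Q) fun s hs => ha s (Finset.mem_range.1 hs)
    refine this.congr fun K => ?_
    rw [sum_range_mul_eq, Finset.sum_div]
  have hdiv : Tendsto (fun N : ℕ => N / Q) atTop atTop := Nat.tendsto_div_const_atTop hQ.ne'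
  have h2 := h1.comp hdiv
  have hratio : Tendsto (fun N : ℕ => ((N / Q : ℕ) : ℝ) / N) atTop (𝓝 (1 / Q)) := by
    have := (tendsto_nat_floor_mul_div_atTop (R := ℝ) (a := 1 / Q) (by positivity)).comp
      tendsto_natCast_atTop_atTop
    refine this.congr fun N => ?_
    simp only [Function.comp]
    congr 2
    rw [one_div, inv_mul_eq_div, Nat.floor_div_natCast, Nat.floor_natCast]
  have h3 := h2.mul hratio
  have herr : Tendsto (fun N : ℕ => (∑ s ∈ Finset.range (N % Q), h (Q * (N / Q) + s)) / N) atTop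
      (𝓝 0) := by
    refine squeeze_zero_norm (a := fun N : ℕ => Q * C / N) (fun N => ?_)
      (tendsto_const_div_atTop_nhds_zero_nat _)
    rw [norm_div, Real.norm_natCast]
    have hC0 : 0 ≤ C := (abs_nonneg _).trans (hC 0)
    gcongr
    refine (norm_sum_le_of_le _ fun s _ => (hC _)).trans ?_
    rw [Finset.sum_const, Finset.card_range, nsmul_eq_mul]
    gcongr
    exact (Nat.mod_lt _ hQ).le
  have h4 := h3.add herr
  rw [add_zero, mul_one_div] at h4
  refine h4.congr' ?_
  filter_upwards [eventually_ge_atTop Q] with N hN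
  have hN0 : (N : ℝ) ≠ 0 := by
    have : 0 < N := hQ.trans_le hN
    positivity
  have hd0 : ((N / Q : ℕ) : ℝ) ≠ 0 := by
    have : 0 < N / Q := Nat.div_pos hN hQ
    positivity
  conv_rhs => rw [← Nat.div_add_mod N Q, Finset.sum_range_add, Nat.div_add_mod]
  simp only [Function.comp]
  field_simp

/-- The word of length `l` at position `i` of `z`. -/
def window (z : BinSeq) (l i : ℕ) : Fin l → Fin 2 := fun t => z (i + t)

/-- Averages along a generic sequence of a function of the position modulo `q` and of the
window at that position. -/
lemma IsGeneric.tendsto_average {z : BinSeq} (hz : IsGeneric z) {q : ℕ} (hq : 0 < q) (l : ℕ)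
    (ψ : ℕ → (Fin l → Fin 2) → ℝ) :
    Tendsto (fun N : ℕ => (∑ i ∈ Finset.range N, ψ (i % q) (window z l i)) / N) atTop
      (𝓝 ((∑ a ∈ Finset.range q, (1 / 2) ^ l * ∑ u, ψ a u) / q)) := by
  classical
  -- The step q(l + 1) is a multiple of q, so the residue modulo q is constant along it, and at
  -- least l, so genericity applies; l + 1 keeps it positive when l = 0.
  have hQ : 0 < q * (l + 1) := by positivity
  have hlQ : l ≤ q * (l + 1) := by nlinarith
  have hbound (i : ℕ) : |ψ (i % q) (window z l i)| ≤ ∑ a ∈ Finset.range q, ∑ u, |ψ a u| := by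
    refine le_trans ?_ (Finset.single_le_sum (f := fun a => ∑ u, |ψ a u|)
      (fun a _ => Finset.sum_nonneg fun u _ => abs_nonneg _)
      (Finset.mem_range.2 (Nat.mod_lt i hq)))
    exact Finset.single_le_sum (f := fun u => |ψ (i % q) u|) (fun u _ => abs_nonneg _)
      (Finset.mem_univ _)
  have key := tendsto_average_of_residues hQ hbound
    (a := fun s => (1 / 2) ^ l * ∑ u, ψ (s % q) u) (by
      intro s _
      have := tendsto_finsetSum Finset.univ fun u (_ : u ∈ Finset.univ) =>
        (hz l _ hlQ hQ s u).const_mul (ψ (s % q) u)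
      rw [← Finset.sum_mul, mul_comm (∑ u, ψ (s % q) u)] at this
      refine this.congr fun K => ?_
      simp_rw [mul_div_assoc', Finset.mul_sum]
      rw [← Finset.sum_div, Finset.sum_comm]
      congr 1
      refine Finset.sum_congr rfl fun k _ => ?_
      rw [Finset.sum_eq_single (window z l (q * (l + 1) * k + s))]
      · have : (q * (l + 1) * k + s) % q = s % q := by
          rw [mul_assoc, Nat.mul_add_mod]
        simp [window, this]
      · intro u _ hu
        rw [if_neg, mul_zero]
        intro h
        exact hu (funext fun t => (h t).symm)
      · simp)
  convert key using 2
  rw [sum_range_mul_eq]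
  simp only [Nat.mul_add_mod, Finset.sum_const, Finset.card_range, nsmul_eq_mul]
  rw [← Finset.mul_sum (a := ((l + 1 : ℕ) : ℝ)), Nat.cast_mul, mul_comm (q : ℝ),
    mul_div_mul_left _ _ (by positivity)]
  congr 1
  exact Finset.sum_congr rfl fun a ha => by rw [Nat.mod_eq_of_lt (Finset.mem_range.1 ha)]

/-- The number of words with prescribed letters off `F` is `2 ^ |F|`. -/
lemma card_words_agreeing {l : ℕ} (F : Finset (Fin l)) (w : Fin l → Fin 2) :
    (Finset.univ.filter fun u : Fin l → Fin 2 => ∀ t ∉ F, u t = w t).card = 2 ^ F.card := by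
  classical
  have : (Finset.univ.filter fun u : Fin l → Fin 2 => ∀ t ∉ F, u t = w t) =
      Fintype.piFinset fun t => if t ∈ F then Finset.univ else {w t} := by
    ext u
    simp only [Finset.mem_filter, Finset.mem_univ, true_and, Fintype.mem_piFinset]
    refine forall_congr' fun t => ?_
    by_cases h : t ∈ F <;> simp [h]
  rw [this, Fintype.card_piFinset]
  have h2 (t : Fin l) : (if t ∈ F then (Finset.univ : Finset (Fin 2)) else {w t}).card =
      if t ∈ F then 2 else 1 := by
    split_ifs <;> simp
  simp_rw [h2]
  rw [Finset.prod_ite_mem, Finset.univ_inter, Finset.prod_const]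

/-- The frequency with which a generic sequence shows prescribed letters at the positions `F`
of a window, the window starting at a given residue. -/
lemma IsGeneric.tendsto_frequency {z : BinSeq} (hz : IsGeneric z) {q : ℕ} (hq : 0 < q) {l : ℕ}
    {j : ℕ} (hj : j < q) (F : Finset (Fin l)) (w : Fin l → Fin 2) :
    Tendsto (fun N : ℕ => (∑ i ∈ Finset.range N,
      if i % q = j ∧ ∀ t ∈ F, z (i + t) = w t then (1 : ℝ) else 0) / N) atTop
      (𝓝 ((1 / 2) ^ F.card / q)) := by
  classical
  have h := hz.tendsto_average hq l
    fun a u => if a = j ∧ ∀ t ∈ F, u t = w t then (1 : ℝ) else 0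
  suffices hval : ∑ a ∈ Finset.range q, (1 / 2 : ℝ) ^ l *
      ∑ u : Fin l → Fin 2, (if a = j ∧ ∀ t ∈ F, u t = w t then (1 : ℝ) else 0) =
      (1 / 2) ^ F.card by
    rw [hval] at h
    exact h
  rw [Finset.sum_eq_single j]
  · have hc := card_words_agreeing Fᶜ w
    simp only [Finset.mem_compl, not_not] at hc
    simp only [true_and, Finset.sum_boole, hc]
    have h2 : F.card + Fᶜ.card = l := by rw [Finset.card_add_card_compl, Fintype.card_fin]
    have h3 : (1 / 2 : ℝ) ^ l = (1 / 2) ^ F.card * (1 / 2) ^ Fᶜ.card := by rw [← pow_add, h2]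
    rw [h3]
    push_cast
    rw [mul_assoc, ← mul_pow]
    norm_num
  · intro a _ ha
    simp [ha]
  · intro h
    exact absurd (Finset.mem_range.2 hj) h

/-! ### Interleavings and the lower entropy bound -/

/-- The sequence reading `z` at the positions congruent to `0, …, p - 1` modulo `q`, and `b` at
the others. -/
def interleave (p q : ℕ) (z b : BinSeq) : BinSeq := fun n => if n % q < p then z n else b n

/-- The frequency of `w` among the first `N` windows of `x`. -/
noncomputable def windowFreq (x : BinSeq) (N : ℕ) {l : ℕ} (w : Fin l → Fin 2) : ℝ :=
  (∑ i ∈ Finset.range N, if window x l i = w then (1 : ℝ) else 0) / N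

lemma windowFreq_nonneg (x : BinSeq) (N : ℕ) {l : ℕ} (w : Fin l → Fin 2) :
    0 ≤ windowFreq x N w := by
  unfold windowFreq
  positivity

lemma sum_windowFreq (x : BinSeq) {N : ℕ} (hN : 0 < N) (l : ℕ) :
    ∑ w : Fin l → Fin 2, windowFreq x N w = 1 := by
  have hN' : (N : ℝ) ≠ 0 := by positivity
  simp only [windowFreq]
  rw [← Finset.sum_div, Finset.sum_comm]
  simp [hN']

lemma slidingProb_eq_windowFreq (x : BinSeq) (n : ℕ) {l : ℕ} (w : Fin l → Fin 2) :
    slidingProb x n w = windowFreq x (n + 1 - l) w := by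
  simp only [slidingProb, slidingCount, windowFreq, Finset.sum_boole, window, funext_iff]

lemma slidingEntropy_eq (x : BinSeq) (l n : ℕ) :
    slidingEntropy x l n =
      (∑ w : Fin l → Fin 2, Real.negMulLog (windowFreq x (n + 1 - l) w)) / (l * Real.log 2) := by
  simp only [slidingEntropy, slidingProb_eq_windowFreq, Real.negMulLog, Real.logb]
  rw [Finset.mul_sum, Finset.sum_div]
  refine Finset.sum_congr rfl fun w _ => ?_
  rw [mul_comm (l : ℝ), ← div_div]
  ring

/-- Turns upper bounds on frequencies into lower bounds on entropy. -/
lemma mul_le_negMulLog {y c : ℝ} (hy : 0 ≤ y) (h : y ≤ Real.exp (-c)) :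
    y * c ≤ Real.negMulLog y := by
  rcases hy.eq_or_lt with rfl | hy
  · simp
  · have := (Real.log_le_iff_le_exp hy).2 h
    rw [Real.negMulLog]
    nlinarith

/-- The offsets of a window starting at residue `j` at which `interleave p q z b` reads `z`. -/
def freeOffsets (p q l j : ℕ) : Finset (Fin l) :=
  Finset.univ.filter fun t => (j + t) % q < p

lemma periodic_mod_lt (p q : ℕ) : Function.Periodic (fun n => n % q < p) q := fun n => by simp

lemma card_filter_mod_lt {p q : ℕ} (hpq : p ≤ q) (s : ℕ) :
    ((Finset.Ico s (s + q)).filter fun n => n % q < p).card = p := by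
  rw [Nat.filter_Ico_card_eq_of_periodic s q _ (periodic_mod_lt p q),
    Nat.count_eq_card_filter_range]
  have : (Finset.range q).filter (fun n => n % q < p) = Finset.range p := by
    ext n
    simp only [Finset.mem_filter, Finset.mem_range]
    constructor
    · rintro ⟨h, h2⟩
      rwa [Nat.mod_eq_of_lt h] at h2
    · intro h
      have : n < q := h.trans_le hpq
      exact ⟨this, by rwa [Nat.mod_eq_of_lt this]⟩
  rw [this, Finset.card_range]

/-- Double counting: each offset is free for exactly p of the q starting residues. -/
lemma sum_card_freeOffsets {p q : ℕ} (hpq : p ≤ q) (l : ℕ) :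
    ∑ j ∈ Finset.range q, (freeOffsets p q l j).card = l * p := by
  simp only [freeOffsets, Finset.card_filter]
  rw [Finset.sum_comm]
  have (t : Fin l) : (∑ j ∈ Finset.range q, if (j + (t : ℕ)) % q < p then 1 else 0) = p := by
    have h := card_filter_mod_lt hpq (t : ℕ)
    rw [Finset.card_filter, Finset.sum_Ico_eq_sum_range, Nat.add_sub_cancel_left] at h
    simpa only [add_comm] using h
  simp [this]

lemma card_freeOffsets_mul {p q : ℕ} (hpq : p ≤ q) (k j : ℕ) :
    (freeOffsets p q (q * k) j).card = k * p := by
  have h : (freeOffsets p q (q * k) j).card =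
      ∑ t ∈ Finset.range (q * k), if (j + t) % q < p then 1 else 0 := by
    rw [freeOffsets, Finset.card_filter,
      Fin.sum_univ_eq_sum_range (fun t => if (j + t) % q < p then 1 else 0)]
  rw [h]
  clear h
  induction k with
  | zero => simp
  | succ k ih =>
    rw [Nat.mul_succ, Finset.sum_range_add, ih, add_mul, one_mul]
    congr 1
    have h := card_filter_mod_lt hpq (j + q * k)
    rw [Finset.card_filter, Finset.sum_Ico_eq_sum_range, Nat.add_sub_cancel_left] at h
    simpa only [add_assoc] using h

/-- The block entropies of an interleaving with a generic sequence are asymptotically at least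
the proportion of generic letters. -/
lemma IsGeneric.eventually_le_entropy {z : BinSeq} (hz : IsGeneric z) {p q : ℕ} (hq : 0 < q)
    (hpq : p ≤ q) (b : BinSeq) (l : ℕ) {ε : ℝ} (hε : 0 < ε) :
    ∀ᶠ N : ℕ in atTop, (l * p / q : ℝ) * Real.log 2 - ε ≤
      ∑ w : Fin l → Fin 2, Real.negMulLog (windowFreq (interleave p q z b) N w) := by
  classical
  set x := interleave p q z b with hx
  have hq' : (0 : ℝ) < q := by exact_mod_cast hq
  -- `R` is the joint frequency of residue and word; `S` relaxes it by testing only the free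
  -- letters, so its limit is known whatever `b` is. The loss ε/2 in `c` leaves room to pass from
  -- that limit to all large N.
  let F := freeOffsets p q l
  let R : ℕ → ℕ → (Fin l → Fin 2) → ℝ := fun N j w =>
    (∑ i ∈ Finset.range N, if i % q = j ∧ window x l i = w then (1 : ℝ) else 0) / N
  let S : ℕ → ℕ → (Fin l → Fin 2) → ℝ := fun N j w =>
    (∑ i ∈ Finset.range N, if i % q = j ∧ ∀ t ∈ F j, z (i + t) = w t then (1 : ℝ) else 0) / N
  let m : ℕ → ℕ → ℝ := fun N j =>
    (∑ i ∈ Finset.range N, if i % q = j then (1 : ℝ) else 0) / N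
  let c : ℕ → ℝ := fun j => (F j).card * Real.log 2 - ε / 2
  have hR0 (N j w) : 0 ≤ R N j w := by simp only [R]; positivity
  have hRS (N j w) : R N j w ≤ S N j w := by
    simp only [R, S]
    gcongr with i _
    split_ifs with h1 h2 h2
    · exact le_rfl
    · refine absurd ⟨h1.1, fun t ht => ?_⟩ h2
      have : (i + t) % q < p := by
        simp only [F, freeOffsets, Finset.mem_filter, Finset.mem_univ, true_and, ← h1.1,
          Nat.mod_add_mod] at ht
        exact ht
      rw [← h1.2]
      simp [window, hx, interleave, this]
    · exact zero_le_one
    · exact le_rfl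
  have hP (N w) : windowFreq x N w = ∑ j ∈ Finset.range q, R N j w := by
    simp only [windowFreq, R]
    rw [← Finset.sum_div, Finset.sum_comm]
    congr 1
    refine Finset.sum_congr rfl fun i _ => ?_
    rw [Finset.sum_eq_single (i % q)]
    · simp
    · intro j _ hj
      simp [hj.symm]
    · intro h
      exact absurd (Finset.mem_range.2 (Nat.mod_lt i hq)) h
  have hm (N j) : ∑ w, R N j w = m N j := by
    simp only [R, m]
    rw [← Finset.sum_div, Finset.sum_comm]
    congr 1
    refine Finset.sum_congr rfl fun i _ => ?_
    by_cases h : i % q = j <;> simp [h]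
  have hmlim : ∀ j ∈ Finset.range q, Tendsto (fun N => m N j) atTop (𝓝 (1 / q)) := by
    intro j hj
    have := hz.tendsto_frequency hq (Finset.mem_range.1 hj) (∅ : Finset (Fin 0)) Fin.elim0
    simpa [m] using this
  have hSev : ∀ᶠ N in atTop, ∀ j ∈ Finset.range q, ∀ w, q * S N j w ≤ Real.exp (-c j) := by
    rw [Finset.eventually_all]
    intro j hj
    rw [eventually_all]
    intro w
    have h1 := (hz.tendsto_frequency hq (Finset.mem_range.1 hj) (F j) w).const_mul (q : ℝ)
    refine (h1.eventually_le_const ?_)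
    rw [mul_div_cancel₀ _ hq'.ne']
    have : (1 / 2 : ℝ) ^ (F j).card = Real.exp (-((F j).card * Real.log 2)) := by
      rw [Real.exp_neg, mul_comm, Real.exp_mul, Real.exp_log two_pos, Real.rpow_natCast]
      simp
    rw [this]
    exact Real.exp_lt_exp.2 (by simp only [c]; linarith)
  have hsum : Tendsto (fun N => ∑ j ∈ Finset.range q, m N j * c j) atTop
      (𝓝 (∑ j ∈ Finset.range q, 1 / q * c j)) :=
    tendsto_finsetSum _ fun j hj => (hmlim j hj).mul_const _
  have hval : ∑ j ∈ Finset.range q, 1 / q * c j = (l * p / q : ℝ) * Real.log 2 - ε / 2 := by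
    have := sum_card_freeOffsets hpq l
    have h2 : ∑ j ∈ Finset.range q, ((F j).card : ℝ) = l * p := by exact_mod_cast this
    rw [← Finset.mul_sum, Finset.sum_sub_distrib, ← Finset.sum_mul, h2]
    simp
    field_simp
  rw [hval] at hsum
  filter_upwards [hSev, hsum.eventually_const_le
    (by linarith : (l * p / q : ℝ) * Real.log 2 - ε < l * p / q * Real.log 2 - ε / 2)]
    with N hN1 hN2
  refine hN2.trans ?_
  have hjensen (w) : ∑ j ∈ Finset.range q, R N j w * c j ≤
      Real.negMulLog (windowFreq x N w) := by
    -- Conditioning lowers entropy: by concavity the entropy of the mixture is at least the mean of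
    -- the entropies at each residue. The weights are exactly 1/q, so q * R is only asymptotically a
    -- conditional distribution, which suffices.
    have h := Real.concaveOn_negMulLog.le_map_sum (t := Finset.range q)
      (w := fun _ => (1 / q : ℝ)) (p := fun j => q * R N j w) (fun _ _ => by positivity)
      (by simp [hq'.ne']) (fun j _ => Set.mem_Ici.2 (mul_nonneg hq'.le (hR0 N j w)))
    have h2 : ∑ j ∈ Finset.range q, (1 / q : ℝ) • (q * R N j w) = windowFreq x N w := by
      rw [hP]
      refine Finset.sum_congr rfl fun j _ => ?_
      rw [smul_eq_mul]
      field_simp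
    rw [h2] at h
    refine le_trans (Finset.sum_le_sum fun j hj => ?_) h
    have h3 := mul_le_negMulLog (c := c j) (mul_nonneg hq'.le (hR0 N j w))
      ((mul_le_mul_of_nonneg_left (hRS N j w) hq'.le).trans (hN1 j hj w))
    rw [smul_eq_mul, one_div, inv_mul_eq_div, le_div_iff₀ hq']
    linarith
  refine le_trans (le_of_eq ?_) (Finset.sum_le_sum fun w _ => hjensen w)
  rw [Finset.sum_comm]
  exact Finset.sum_congr rfl fun j _ => by rw [← hm, Finset.sum_mul]

/-! ### Word counting and the upper entropy bound -/

/-- The entropy of a distribution carried by `S` is at most `log |S|`. -/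
lemma sum_negMulLog_le_log_card {ι : Type*} [Fintype ι] (P : ι → ℝ) (h0 : ∀ i, 0 ≤ P i)
    (h1 : ∑ i, P i = 1) (S : Finset ι) (hS : ∀ i ∉ S, P i = 0) :
    ∑ i, Real.negMulLog (P i) ≤ Real.log S.card := by
  have hres : ∑ i ∈ S, P i = 1 := by
    rw [← h1]
    exact Finset.sum_subset (Finset.subset_univ S) fun i _ hi => hS i hi
  have hne : S.Nonempty := by
    rw [Finset.nonempty_iff_ne_empty]
    rintro rfl
    simp at hres
  have hA : (0 : ℝ) < S.card := by exact_mod_cast hne.card_pos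
  have hterm (i : ι) : Real.negMulLog (P i) ≤ P i * Real.log S.card + ((S.card : ℝ)⁻¹ - P i) := by
    rcases (h0 i).eq_or_lt with h | h
    · rw [← h]
      simp
    · have h2 := Real.log_le_sub_one_of_pos (x := ((S.card : ℝ) * P i)⁻¹) (by positivity)
      rw [Real.log_inv, Real.log_mul hA.ne' h.ne', mul_inv] at h2
      have h3 := mul_le_mul_of_nonneg_left h2 h.le
      have h4 : P i * ((S.card : ℝ)⁻¹ * (P i)⁻¹ - 1) = (S.card : ℝ)⁻¹ - P i := by
        field_simp
      rw [h4] at h3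
      rw [Real.negMulLog]
      linarith
  have hsub : ∑ i, Real.negMulLog (P i) = ∑ i ∈ S, Real.negMulLog (P i) :=
    (Finset.sum_subset (Finset.subset_univ S) fun i _ hi => by simp [hS i hi]).symm
  rw [hsub]
  refine (Finset.sum_le_sum fun i _ => hterm i).trans (le_of_eq ?_)
  rw [Finset.sum_add_distrib, Finset.sum_sub_distrib, ← Finset.sum_mul, hres, Finset.sum_const,
    nsmul_eq_mul, mul_inv_cancel₀ hA.ne']
  ring

/-- The letter `0` if `k` is even, and `1` if `k` is odd. -/
def parityBit (k : ℕ) : Fin 2 := if k % 2 = 0 then 0 else 1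

/-- The sequence which is constant on the dyadic intervals `[2 ^ k, 2 ^ (k + 1))`, with the
parity of `k` as its value. -/
def dyadicPhase : BinSeq := fun n => parityBit (Nat.log 2 n)

/-- A window starting at i ≥ l meets at most one change of phase, so it is a constant block followed
by the opposite block: 2(l + 1) words. The l earlier windows are added one by one. -/
lemma exists_words_dyadicPhase (l : ℕ) :
    ∃ B : Finset (Fin l → Fin 2), B.card ≤ 3 * l + 2 ∧ ∀ i, window dyadicPhase l i ∈ B := by
  classical
  let g : ℕ × Fin 2 → (Fin l → Fin 2) := fun s t => if (t : ℕ) < s.1 then s.2 else 1 - s.2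
  refine ⟨(Finset.range l).image (window dyadicPhase l) ∪
    (Finset.range (l + 1) ×ˢ Finset.univ).image g, ?_, fun i => ?_⟩
  · refine (Finset.card_union_le _ _).trans ?_
    have h1 := Finset.card_image_le (s := Finset.range l) (f := window dyadicPhase l)
    have h2 := Finset.card_image_le (s := Finset.range (l + 1) ×ˢ (Finset.univ : Finset (Fin 2)))
      (f := g)
    simp only [Finset.card_range, Finset.card_product, Finset.card_univ, Fintype.card_fin] at h1 h2
    omega
  · rw [Finset.mem_union]
    rcases lt_or_ge i l with hi | hi
    · exact Or.inl (Finset.mem_image_of_mem _ (Finset.mem_range.2 hi))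
    · right
      rcases Nat.eq_zero_or_pos i with rfl | hi0
      · obtain rfl : l = 0 := by omega
        exact Finset.mem_image.2 ⟨(0, 0), by simp, funext fun t => t.elim0⟩
      -- The first block ends at the next power of two, or with the window.
      refine Finset.mem_image.2 ⟨(min (2 ^ (Nat.log 2 i + 1) - i) l, dyadicPhase i), ?_, ?_⟩
      · simp only [Finset.mem_product, Finset.mem_range, Finset.mem_univ, and_true]
        omega
      · funext t
        have ht := t.isLt
        have hlow : 2 ^ Nat.log 2 i ≤ i := Nat.pow_log_le_self 2 hi0.ne'
        have hup : i < 2 ^ (Nat.log 2 i + 1) := Nat.lt_pow_succ_log_self (by norm_num) i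
        simp only [g, window]
        split_ifs with h
        · have : Nat.log 2 (i + t) = Nat.log 2 i := by
            apply Nat.log_eq_of_pow_le_of_lt_pow <;> omega
          simp [dyadicPhase, this]
        · have : Nat.log 2 (i + t) = Nat.log 2 i + 1 := by
            -- Since t < l ≤ i < 2^(log i + 1), the index i + t stays below the second power of two
            -- after i.
            have hp : 2 ^ (Nat.log 2 i + 1 + 1) = 2 * 2 ^ (Nat.log 2 i + 1) := by ring
            apply Nat.log_eq_of_pow_le_of_lt_pow <;> omega
          simp only [dyadicPhase, parityBit, this]
          rcases Nat.mod_two_eq_zero_or_one (Nat.log 2 i) with h2 | h2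
          · simp [h2, Nat.add_mod]
          · simp [h2, Nat.add_mod]

/-- An interleaving with the dyadic phases has few words whose length is a multiple of the
period. -/
lemma exists_words_interleave {p q : ℕ} (hq : 0 < q) (hpq : p ≤ q) (z : BinSeq) (k : ℕ) :
    ∃ S : Finset (Fin (q * k) → Fin 2), S.card ≤ q * (3 * (q * k) + 2) * 2 ^ (k * p) ∧
      ∀ i, window (interleave p q z dyadicPhase) (q * k) i ∈ S := by
  classical
  obtain ⟨B, hB, hBmem⟩ := exists_words_dyadicPhase (q * k)
  refine ⟨(Finset.range q ×ˢ B).biUnion fun a => Finset.univ.filter fun u =>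
    ∀ t ∉ freeOffsets p q (q * k) a.1, u t = a.2 t, ?_, fun i => ?_⟩
  · refine (Finset.card_biUnion_le_card_mul _ _ (2 ^ (k * p)) fun a _ => ?_).trans ?_
    · rw [card_words_agreeing, card_freeOffsets_mul hpq]
    · rw [Finset.card_product, Finset.card_range]
      gcongr
  · refine Finset.mem_biUnion.2 ⟨(i % q, window dyadicPhase (q * k) i), ?_, ?_⟩
    · exact Finset.mem_product.2 ⟨Finset.mem_range.2 (Nat.mod_lt i hq), hBmem i⟩
    · simp only [Finset.mem_filter, Finset.mem_univ, true_and, freeOffsets, Nat.mod_add_mod]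
      intro t ht
      simp [window, interleave, ht]

lemma entropy_le_log_card (x : BinSeq) {l N : ℕ} (hN : 0 < N) (S : Finset (Fin l → Fin 2))
    (hS : ∀ i, window x l i ∈ S) :
    ∑ w : Fin l → Fin 2, Real.negMulLog (windowFreq x N w) ≤ Real.log S.card := by
  refine sum_negMulLog_le_log_card _ (windowFreq_nonneg x N) (sum_windowFreq x hN l) S ?_
  intro w hw
  simp only [windowFreq]
  rw [Finset.sum_eq_zero, zero_div]
  intro i _
  rw [if_neg]
  rintro rfl
  exact hw (hS i)

lemma entropy_nonneg (x : BinSeq) (N l : ℕ) :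
    0 ≤ ∑ w : Fin l → Fin 2, Real.negMulLog (windowFreq x N w) := by
  rcases Nat.eq_zero_or_pos N with rfl | hN
  · simp [windowFreq]
  refine Finset.sum_nonneg fun w _ => Real.negMulLog_nonneg (windowFreq_nonneg x N w) ?_
  rw [← sum_windowFreq x hN l]
  exact Finset.single_le_sum (f := windowFreq x N) (fun w _ => windowFreq_nonneg x N w)
    (Finset.mem_univ w)

/-! ### Bounds on the two dimensions -/

lemma slidingEntropy_nonneg (x : BinSeq) (l n : ℕ) : 0 ≤ slidingEntropy x l n := by
  rw [slidingEntropy_eq]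
  have := Real.log_pos one_lt_two
  exact div_nonneg (entropy_nonneg x _ l) (by positivity)

/-- Block entropies are bounded by the logarithm of the number of words. -/
lemma slidingEntropy_le (x : BinSeq) {l n : ℕ} (hn : l ≤ n) (S : Finset (Fin l → Fin 2))
    (hS : ∀ i, window x l i ∈ S) :
    slidingEntropy x l n ≤ Real.log S.card / (l * Real.log 2) := by
  rw [slidingEntropy_eq]
  have := Real.log_pos one_lt_two
  gcongr
  exact entropy_le_log_card x (by omega) S hS

lemma isBoundedUnder_ge_slidingEntropy (x : BinSeq) (l : ℕ) :
    IsBoundedUnder (· ≥ ·) atTop fun n => slidingEntropy x l n :=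
  isBoundedUnder_of ⟨0, fun n => slidingEntropy_nonneg x l n⟩

lemma isBoundedUnder_le_slidingEntropy (x : BinSeq) (l : ℕ) :
    IsBoundedUnder (· ≤ ·) atTop fun n => slidingEntropy x l n :=
  isBoundedUnder_of_eventually_le (a := Real.log (Finset.univ : Finset (Fin l → Fin 2)).card /
    (l * Real.log 2)) (by
    filter_upwards [eventually_ge_atTop l] with n hn
    exact slidingEntropy_le x hn _ fun i => Finset.mem_univ _)

lemma bddBelow_liminf (x : BinSeq) :
    BddBelow (Set.range fun l : ℕ+ => liminf (fun n => slidingEntropy x l n) atTop) := by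
  refine ⟨0, ?_⟩
  rintro _ ⟨l, rfl⟩
  exact le_liminf_of_le (isBoundedUnder_le_slidingEntropy x l).isCoboundedUnder_ge
    (Eventually.of_forall fun n => slidingEntropy_nonneg x l n)

lemma bddBelow_limsup (x : BinSeq) :
    BddBelow (Set.range fun l : ℕ+ => limsup (fun n => slidingEntropy x l n) atTop) := by
  obtain ⟨c, hc⟩ := bddBelow_liminf x
  refine ⟨c, ?_⟩
  rintro _ ⟨l, rfl⟩
  exact (hc ⟨l, rfl⟩).trans (liminf_le_limsup (isBoundedUnder_le_slidingEntropy x l)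
    (isBoundedUnder_ge_slidingEntropy x l))

lemma dimFS_le_strongDimFS (x : BinSeq) : dimFS x ≤ strongDimFS x :=
  ciInf_mono (bddBelow_liminf x) fun l => liminf_le_limsup (isBoundedUnder_le_slidingEntropy x l)
    (isBoundedUnder_ge_slidingEntropy x l)

lemma IsGeneric.le_dimFS_interleave {z : BinSeq} (hz : IsGeneric z) {p q : ℕ} (hq : 0 < q)
    (hpq : p ≤ q) (b : BinSeq) : (p / q : ℝ) ≤ dimFS (interleave p q z b) := by
  refine le_ciInf fun l => ?_
  refine le_of_forall_pos_le_add fun ε hε => ?_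
  rw [← sub_le_iff_le_add]
  refine le_liminf_of_le (isBoundedUnder_le_slidingEntropy _ l).isCoboundedUnder_ge ?_
  have hlog := Real.log_pos one_lt_two
  have hl : (0 : ℝ) < (l : ℕ) := by exact_mod_cast l.pos
  have hq' : (0 : ℝ) < q := by exact_mod_cast hq
  have h := hz.eventually_le_entropy hq hpq b l (ε := ε * ((l : ℕ) * Real.log 2)) (by positivity)
  have ht : Tendsto (fun n : ℕ => n + 1 - (l : ℕ)) atTop atTop :=
    (tendsto_sub_atTop_nat _).comp (tendsto_add_atTop_nat 1)
  filter_upwards [ht.eventually h] with n hn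
  rw [slidingEntropy_eq, le_div_iff₀ (by positivity)]
  refine le_trans (le_of_eq ?_) hn
  field_simp

/-- The infimum allows restricting to lengths qk, where every window has exactly kp free letters.
The polynomial factor in the word count costs O(log k / k), the first term of `B`. -/
lemma strongDimFS_interleave_le {p q : ℕ} (hq : 0 < q) (hpq : p ≤ q) (z : BinSeq) :
    strongDimFS (interleave p q z dyadicPhase) ≤ p / q := by
  have hlog := Real.log_pos one_lt_two
  have hq' : (0 : ℝ) < q := by exact_mod_cast hq
  let B : ℕ → ℝ := fun k => Real.log (q * (3 * (q * k) + 2)) / (q * k * Real.log 2) + p / q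
  have hbound (k : ℕ) (hk : 0 < k) : strongDimFS (interleave p q z dyadicPhase) ≤ B k := by
    refine (ciInf_le (bddBelow_limsup _) ⟨q * k, by positivity⟩).trans ?_
    refine limsup_le_of_le (isBoundedUnder_ge_slidingEntropy _ _).isCoboundedUnder_le ?_
    obtain ⟨S, hS, hSmem⟩ := exists_words_interleave hq hpq z k
    filter_upwards [eventually_ge_atTop (q * k)] with n hn
    have hk' : (0 : ℝ) < k := by exact_mod_cast hk
    refine (slidingEntropy_le _ hn S hSmem).trans ?_
    have hpos : (0 : ℝ) < S.card := by
      exact_mod_cast Finset.card_pos.2 ⟨_, hSmem 0⟩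
    have hle : Real.log S.card ≤ Real.log (q * (3 * (q * k) + 2)) + k * p * Real.log 2 := by
      have h1 : (S.card : ℝ) ≤ q * (3 * (q * k) + 2) * 2 ^ (k * p) := by exact_mod_cast hS
      refine (Real.log_le_log hpos h1).trans (le_of_eq ?_)
      rw [Real.log_mul (by positivity) (by positivity), Real.log_pow]
      push_cast
      ring
    push_cast
    rw [div_le_iff₀ (by positivity)]
    refine hle.trans (le_of_eq ?_)
    simp only [B]
    field_simp
  have hlim : Tendsto B atTop (𝓝 (p / q)) := by
    have h1 : Tendsto (fun k : ℕ => Real.log (q * (3 * (q * k) + 2)) / (q * k * Real.log 2))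
        atTop (𝓝 0) := by
      have ha : Tendsto (fun k : ℕ => (q * (3 * (q * k) + 2) : ℝ)) atTop atTop := by
        refine Tendsto.const_mul_atTop hq' (tendsto_atTop_add_const_right _ _
          (Tendsto.const_mul_atTop three_pos (Tendsto.const_mul_atTop hq'
            tendsto_natCast_atTop_atTop)))
      have hb := (Real.isLittleO_log_id_atTop.comp_tendsto ha).tendsto_div_nhds_zero
      have hc : Tendsto (fun k : ℕ => (q * (3 * (q * k) + 2) : ℝ) / (q * k * Real.log 2)) atTop
          (𝓝 (3 * q / Real.log 2)) := by
        have h2 : Tendsto (fun k : ℕ => (3 * q / Real.log 2 + 2 / Real.log 2 / k : ℝ)) atTop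
            (𝓝 (3 * q / Real.log 2 + 0)) :=
          tendsto_const_nhds.add (tendsto_const_div_atTop_nhds_zero_nat _)
        rw [add_zero] at h2
        refine h2.congr' ?_
        filter_upwards [eventually_gt_atTop 0] with k hk
        have hk' : (0 : ℝ) < k := by exact_mod_cast hk
        field_simp
      have hd := hb.mul hc
      rw [zero_mul] at hd
      refine hd.congr fun k => ?_
      simp only [Function.comp, id]
      have : (q * (3 * (q * k) + 2) : ℝ) ≠ 0 := by positivity
      rw [div_mul_div_cancel₀ this]
    simpa [B] using h1.add_const (p / q : ℝ)
  refine ge_of_tendsto hlim ?_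
  filter_upwards [eventually_gt_atTop 0] with k hk
  exact hbound k hk

/-! ### Sines of shifted binary values -/

/-- The imaginary part of `exp (2πi v)` for `v` the number with binary digits `d`. -/
noncomputable def sinVal (d : BinSeq) : ℝ := Real.sin (2 * Real.pi * Real.ofDigits d)

lemma value_eq_fract_ofDigits (x : BinSeq) : value x = Int.fract (Real.ofDigits x) := by
  simp only [value, Real.ofDigits, Real.ofDigitsTerm, div_eq_mul_inv, Nat.cast_ofNat]

lemma shift_iterate (x : BinSeq) (j : ℕ) : shift^[j] x = fun t => x (j + t) := by
  induction j generalizing x with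
  | zero => simp
  | succ j ih =>
    rw [Function.iterate_succ_apply, ih]
    funext t
    simp only [shift]
    congr 1
    omega

lemma im_exp_value (x : BinSeq) :
    (Complex.exp (2 * (Real.pi : ℂ) * Complex.I * ((1 : ℤ) : ℂ) * (value x : ℂ))).im =
      sinVal x := by
  have : (2 * (Real.pi : ℂ) * Complex.I * ((1 : ℤ) : ℂ) * (value x : ℂ)) =
      ((2 * Real.pi * value x : ℝ) : ℂ) * Complex.I := by
    push_cast
    ring
  rw [this, Complex.exp_ofReal_mul_I_im, value_eq_fract_ofDigits, Int.fract, sinVal, mul_sub,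
    mul_comm (2 * Real.pi) ((⌊Real.ofDigits x⌋ : ℤ) : ℝ), Real.sin_sub_int_mul_two_pi]

lemma im_weylAverage (x : BinSeq) (n : ℕ) :
    (weylAverage x 1 n).im = (∑ j ∈ Finset.range n, sinVal fun t => x (j + t)) / n := by
  rw [weylAverage, Complex.div_natCast_im, Complex.im_sum]
  simp only [im_exp_value, shift_iterate]

lemma ofDigits_eq_head_add_tail (d : BinSeq) :
    Real.ofDigits d = (d 0 : ℕ) / 2 + Real.ofDigits (fun t => d (t + 1)) / 2 := by
  rw [Real.ofDigits_eq_sum_add_ofDigits d 1]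
  simp [Real.ofDigitsTerm]
  ring

/-- Changing the leading digit moves the angle by π. -/
lemma sinVal_flip {d e : BinSeq} (h0 : e 0 = 1 - d 0) (h : ∀ t, e (t + 1) = d (t + 1)) :
    sinVal d + sinVal e = 0 := by
  rw [sinVal, sinVal, ofDigits_eq_head_add_tail d, ofDigits_eq_head_add_tail e]
  simp only [h, h0]
  set y := Real.ofDigits fun t => d (t + 1)
  rcases Fin.exists_fin_two.1 ⟨d 0, rfl⟩ with h | h
  · rw [h, show 2 * Real.pi * ((((1 - 0 : Fin 2) : ℕ) : ℝ) / 2 + y / 2) =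
      2 * Real.pi * ((((0 : Fin 2) : ℕ) : ℝ) / 2 + y / 2) + Real.pi by simp; ring,
      Real.sin_add_pi]
    ring
  · rw [h, show 2 * Real.pi * ((((1 : Fin 2) : ℕ) : ℝ) / 2 + y / 2) =
      2 * Real.pi * ((((1 - 1 : Fin 2) : ℕ) : ℝ) / 2 + y / 2) + Real.pi by simp; ring,
      Real.sin_add_pi]
    ring

lemma sinVal_nonneg {d : BinSeq} (h0 : d 0 = 0) : 0 ≤ sinVal d := by
  have h1 := Real.ofDigits_nonneg fun t => d (t + 1)
  have h2 := Real.ofDigits_le_one fun t => d (t + 1)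
  have := Real.pi_pos
  rw [sinVal, ofDigits_eq_head_add_tail d, h0]
  apply Real.sin_nonneg_of_nonneg_of_le_pi
  · positivity
  · simp
    nlinarith

lemma sinVal_nonpos {d : BinSeq} (h0 : d 0 = 1) : sinVal d ≤ 0 := by
  have h := sinVal_flip (d := d) (e := fun t => if t = 0 then 0 else d t) (by simp [h0])
    (fun t => by simp)
  have h2 := sinVal_nonneg (d := fun t => if t = 0 then 0 else d t) (by simp)
  linarith

/-- The digits 010 put the angle in [π/2, 3π/4]. -/
lemma half_le_sinVal {d : BinSeq} (h0 : d 0 = 0) (h1 : d 1 = 1) (h2 : d 2 = 0) :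
    1 / 2 ≤ sinVal d := by
  have ha := Real.ofDigits_nonneg fun t => d (t + 1 + 1 + 1)
  have hb := Real.ofDigits_le_one fun t => d (t + 1 + 1 + 1)
  have hd : Real.ofDigits d = 1 / 4 + Real.ofDigits (fun t => d (t + 1 + 1 + 1)) / 8 := by
    rw [ofDigits_eq_head_add_tail d, ofDigits_eq_head_add_tail fun t => d (t + 1),
      ofDigits_eq_head_add_tail fun t => d (t + 1 + 1)]
    simp [h0, h1, h2]
    ring
  rw [sinVal, hd]
  set y := Real.ofDigits fun t => d (t + 1 + 1 + 1)
  have hpi := Real.pi_pos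
  rw [show 2 * Real.pi * (1 / 4 + y / 8) = Real.pi / 4 * y + Real.pi / 2 by ring,
    Real.sin_add_pi_div_two, ← Real.cos_pi_div_three]
  apply Real.cos_le_cos_of_nonneg_of_le_pi
  · positivity
  · linarith
  · nlinarith

lemma abs_sinVal_le_one (d : BinSeq) : |sinVal d| ≤ 1 := Real.abs_sin_le_one _

lemma abs_sinVal_sub_le {d e : BinSeq} {L : ℕ} (h : ∀ t < L, d t = e t) :
    |sinVal d - sinVal e| ≤ 2 * Real.pi / 2 ^ L := by
  have hpi := Real.pi_pos
  refine (Real.abs_sin_sub_sin_le _ _).trans ?_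
  rw [← mul_sub, abs_mul, abs_of_pos (by positivity : 0 < 2 * Real.pi), div_eq_mul_inv]
  gcongr
  exact_mod_cast Real.abs_ofDigits_sub_ofDigits_le h

/-- The continuation by `β` and the word `u` of an interleaving of period `q`, seen from a position
with residue `a`. -/
def mergeWord (p q : ℕ) (β : Fin 2) (a : ℕ) {L : ℕ} (u : Fin L → Fin 2) : BinSeq :=
  fun t => if (a + t) % q < p then (if h : t < L then u ⟨t, h⟩ else 0) else β

/-- The mean over the residues `a` and the words `u` of `sinVal (mergeWord p q β a u)`. -/
noncomputable def phaseMean (p q L : ℕ) (β : Fin 2) : ℝ :=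
  (∑ a ∈ Finset.range q, (1 / 2) ^ L * ∑ u : Fin L → Fin 2, sinVal (mergeWord p q β a u)) / q

/-- As a < p, the leading letter is free; toggling it pairs words with opposite sines. -/
lemma sum_sinVal_mergeWord_eq_zero {p q a : ℕ} (hpq : p ≤ q) (ha : a < p) (β : Fin 2) (M : ℕ) :
    ∑ u : Fin (M + 3) → Fin 2, sinVal (mergeWord p q β a u) = 0 := by
  have hmod : a % q = a := Nat.mod_eq_of_lt (ha.trans_le hpq)
  refine Finset.sum_involution (fun u _ => Function.update u 0 (1 - u 0)) ?_ ?_ ?_ ?_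
  · intro u _
    apply sinVal_flip
    · simp [mergeWord, hmod, ha]
    · intro t
      have (h : t + 1 < M + 3) : (⟨t + 1, h⟩ : Fin (M + 3)) ≠ 0 := by simp [Fin.ext_iff]
      simp [mergeWord, this]
  · intro u _ _ h
    have := congrFun h 0
    rw [Function.update_self] at this
    generalize u 0 = v at this
    revert v
    decide
  · intro u _
    exact Finset.mem_univ _
  · intro u _
    funext t
    by_cases ht : t = 0
    · subst ht
      simp
    · simp [ht]

lemma phaseMean_one_nonpos {p q : ℕ} (hpq : p ≤ q) (M : ℕ) : phaseMean p q (M + 3) 1 ≤ 0 := by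
  refine div_nonpos_of_nonpos_of_nonneg (Finset.sum_nonpos fun a ha => ?_) (by positivity)
  refine mul_nonpos_of_nonneg_of_nonpos (by positivity) ?_
  rcases lt_or_ge a p with hap | hap
  · exact (sum_sinVal_mergeWord_eq_zero hpq hap 1 M).le
  · refine Finset.sum_nonpos fun u _ => sinVal_nonpos ?_
    simp [mergeWord, Nat.mod_eq_of_lt (Finset.mem_range.1 ha), hap]

/-- No residue contributes negatively. From residue q - 1 the leading letter is the phase 0 and, as
p ≥ 2, the next two are free; a quarter of the words continue with 10, each giving at least 1/2,
whence 1/8 before dividing by q. -/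
lemma le_phaseMean_zero {p q : ℕ} (hp : 2 ≤ p) (hpq : p < q) (M : ℕ) :
    1 / (8 * q : ℝ) ≤ phaseMean p q (M + 3) 0 := by
  classical
  have hq' : (0 : ℝ) < q := by
    have : 0 < q := by omega
    exact_mod_cast this
  have hfirst {a : ℕ} (ha : a < q) (hap : p ≤ a) (u : Fin (M + 3) → Fin 2) :
      mergeWord p q 0 a u 0 = 0 := by
    simp [mergeWord, Nat.mod_eq_of_lt ha, hap]
  rw [phaseMean, ← div_div]
  gcongr
  have hsingle : (1 / 2 : ℝ) ^ (M + 3) *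
      ∑ u : Fin (M + 3) → Fin 2, sinVal (mergeWord p q 0 (q - 1) u) ≤
      ∑ a ∈ Finset.range q, (1 / 2) ^ (M + 3) *
        ∑ u : Fin (M + 3) → Fin 2, sinVal (mergeWord p q 0 a u) := by
    refine Finset.single_le_sum (f := fun a => (1 / 2 : ℝ) ^ (M + 3) *
      ∑ u : Fin (M + 3) → Fin 2, sinVal (mergeWord p q 0 a u)) (fun a ha => ?_)
      (Finset.mem_range.2 (by omega))
    refine mul_nonneg (by positivity) ?_
    rcases lt_or_ge a p with hap | hap
    · exact (sum_sinVal_mergeWord_eq_zero hpq.le hap 0 M).ge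
    · exact Finset.sum_nonneg fun u _ =>
        sinVal_nonneg (hfirst (Finset.mem_range.1 ha) hap u)
  refine le_trans ?_ hsingle
  let F : Finset (Fin (M + 3)) := {1, 2}ᶜ
  let w : Fin (M + 3) → Fin 2 := fun t => if t = 1 then 1 else 0
  have hmod2 : 2 % (M + 3) = 2 := Nat.mod_eq_of_lt (by omega)
  have h21 : (2 : Fin (M + 3)) ≠ 1 := by simp [Fin.ext_iff, hmod2]
  have hF : F.card = M + 1 := by
    rw [Finset.card_compl, Finset.card_pair h21.symm, Fintype.card_fin]
    omega
  have hsub : ∑ u ∈ Finset.univ.filter (fun u : Fin (M + 3) → Fin 2 => ∀ t ∉ F, u t = w t),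
      (1 / 2 : ℝ) ≤ ∑ u : Fin (M + 3) → Fin 2, sinVal (mergeWord p q 0 (q - 1) u) := by
    refine le_trans (Finset.sum_le_sum fun u hu => ?_)
      (Finset.sum_le_sum_of_subset_of_nonneg (Finset.filter_subset _ _) fun u _ _ =>
        sinVal_nonneg (hfirst (by omega) (by omega) u))
    have hu' := (Finset.mem_filter.1 hu).2
    have hm1 : (q - 1 + 1) % q = 0 := by
      rw [Nat.sub_add_cancel (by omega), Nat.mod_self]
    have hm2 : (q - 1 + 2) % q = 1 := by
      rw [show q - 1 + 2 = q + 1 by omega, Nat.add_mod_left, Nat.mod_eq_of_lt (by omega)]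
    refine half_le_sinVal (hfirst (by omega) (by omega) u) ?_ ?_
    · have h1 := hu' 1 (by simp [F])
      have : (⟨1, by omega⟩ : Fin (M + 3)) = 1 := by simp
      simp only [mergeWord, hm1]
      rw [if_pos (by omega), dif_pos (by omega), this, h1]
      simp [w]
    · have h1 := hu' 2 (by simp [F])
      have : (⟨2, by omega⟩ : Fin (M + 3)) = 2 := by simp [Fin.ext_iff, hmod2]
      simp only [mergeWord, hm2]
      rw [if_pos (by omega), dif_pos (by omega), this, h1]
      simp [w, h21]
  rw [Finset.sum_const, card_words_agreeing, hF, nsmul_eq_mul] at hsub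
  refine le_trans (le_of_eq ?_) (mul_le_mul_of_nonneg_left hsub (by positivity))
  push_cast
  rw [pow_add, pow_add, one_div_pow]
  field_simp
  norm_num

/-! ### Divergence of the Weyl averages -/

/-- Averages over the dyadic intervals converge if the averages do. -/
lemma tendsto_dyadic_average {h : ℕ → ℝ} {c : ℝ}
    (hc : Tendsto (fun N : ℕ => (∑ i ∈ Finset.range N, h i) / N) atTop (𝓝 c)) :
    Tendsto (fun K : ℕ => (∑ i ∈ Finset.Ico (2 ^ K) (2 ^ (K + 1)), h i) / 2 ^ K) atTop (𝓝 c) := by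
  have hpow : Tendsto (fun K : ℕ => 2 ^ K) atTop atTop :=
    tendsto_pow_atTop_atTop_of_one_lt one_lt_two
  have h1 := hc.comp hpow
  have h2 := (hc.comp (hpow.comp (tendsto_add_atTop_nat 1))).const_mul 2
  -- The mean over [2^K, 2^(K+1)) is twice the average up to 2^(K+1) minus the average up to 2^K.
  have h3 := h2.sub h1
  rw [show 2 * c - c = c by ring] at h3
  refine h3.congr fun K => ?_
  rw [Finset.sum_Ico_eq_sub _ (Nat.pow_le_pow_right two_pos K.le_succ)]
  simp only [Function.comp]
  push_cast
  rw [pow_succ' (2 : ℝ), ← mul_div_assoc, mul_div_mul_left _ _ two_ne_zero, ← sub_div]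

/-- Windows of length L inside the phase agree with the model in L digits. At most L starting points
have windows leaving it, and each costs at most 2. -/
lemma sum_dyadic_sub_le {p q : ℕ} (z : BinSeq) (L K : ℕ) {β : Fin 2} (hK : parityBit K = β) :
    |∑ i ∈ Finset.Ico (2 ^ K) (2 ^ (K + 1)),
      ((sinVal fun t => interleave p q z dyadicPhase (i + t)) -
        sinVal (mergeWord p q β (i % q) (window z L i)))| ≤
      2 ^ K * (2 * Real.pi / 2 ^ L) + 2 * L := by
  have hpi := Real.pi_pos
  have hterm : ∀ i ∈ Finset.Ico (2 ^ K) (2 ^ (K + 1)),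
      |(sinVal fun t => interleave p q z dyadicPhase (i + t)) -
        sinVal (mergeWord p q β (i % q) (window z L i))| ≤
      2 * Real.pi / 2 ^ L + if 2 ^ (K + 1) < i + L then 2 else 0 := by
    intro i hi
    rw [Finset.mem_Ico] at hi
    split_ifs with h
    · have h1 := abs_sub (sinVal fun t => interleave p q z dyadicPhase (i + t))
        (sinVal (mergeWord p q β (i % q) (window z L i)))
      have h2 := abs_sinVal_le_one fun t => interleave p q z dyadicPhase (i + t)
      have h3 := abs_sinVal_le_one (mergeWord p q β (i % q) (window z L i))
      have : 0 ≤ 2 * Real.pi / 2 ^ L := by positivity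
      linarith
    · rw [add_zero]
      refine abs_sinVal_sub_le fun t ht => ?_
      have hlog : Nat.log 2 (i + t) = K := by
        apply Nat.log_eq_of_pow_le_of_lt_pow <;> omega
      simp only [interleave, mergeWord, Nat.mod_add_mod, dyadicPhase, hlog, hK, window, ht,
        dif_pos]
  refine (Finset.abs_sum_le_sum_abs _ _).trans ((Finset.sum_le_sum hterm).trans ?_)
  rw [Finset.sum_add_distrib, Finset.sum_const, Nat.card_Ico, nsmul_eq_mul, ← Finset.sum_filter,
    Finset.sum_const, nsmul_eq_mul]
  have hc1 : 2 ^ (K + 1) - 2 ^ K = 2 ^ K := by rw [pow_succ]; omega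
  have hc2 : ((Finset.Ico (2 ^ K) (2 ^ (K + 1))).filter fun i => 2 ^ (K + 1) < i + L).card ≤ L := by
    refine (Finset.card_le_card (t := Finset.Ico (2 ^ (K + 1) - L) (2 ^ (K + 1))) ?_).trans ?_
    · intro i hi
      simp only [Finset.mem_filter, Finset.mem_Ico] at hi ⊢
      omega
    · rw [Nat.card_Ico]
      omega
  have hc3 : (((Finset.Ico (2 ^ K) (2 ^ (K + 1))).filter
      fun i => 2 ^ (K + 1) < i + L).card : ℝ) ≤ L := by exact_mod_cast hc2
  rw [hc1]
  push_cast
  linarith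

/-- Any limit of the averages is also the limit of the means over the phases of value β alone. The
boundary cost 2L / 2^K vanishes, leaving only the truncation error. -/
lemma IsGeneric.abs_sub_phaseMean_le {z : BinSeq} (hz : IsGeneric z) {p q : ℕ} (hq : 0 < q)
    (L : ℕ) {β : Fin 2} {κ : ℕ → ℕ} (hκ : Tendsto κ atTop atTop) (hβ : ∀ k, parityBit (κ k) = β)
    {c : ℝ} (hc : Tendsto (fun N : ℕ => (∑ i ∈ Finset.range N,
      sinVal fun t => interleave p q z dyadicPhase (i + t)) / N) atTop (𝓝 c)) :
    |c - phaseMean p q L β| ≤ 2 * Real.pi / 2 ^ L := by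
  have h1 := (tendsto_dyadic_average hc).comp hκ
  have h2 := (tendsto_dyadic_average (hz.tendsto_average hq L
    fun a u => sinVal (mergeWord p q β a u))).comp hκ
  have h3 := (h1.sub h2).abs
  have h4 : Tendsto (fun k => 2 * Real.pi / 2 ^ L + 2 * L / (2 : ℝ) ^ κ k) atTop
      (𝓝 (2 * Real.pi / 2 ^ L + 0)) := by
    refine tendsto_const_nhds.add (Tendsto.const_div_atTop ?_ _)
    exact (tendsto_pow_atTop_atTop_of_one_lt one_lt_two).comp hκ
  rw [add_zero] at h4
  refine le_of_tendsto_of_tendsto' h3 h4 fun k => ?_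
  have h := sum_dyadic_sub_le (p := p) (q := q) z L (κ k) (hβ k)
  simp only [Function.comp]
  rw [← sub_div, ← Finset.sum_sub_distrib, abs_div, abs_of_pos (by positivity : (0 : ℝ) < 2 ^ κ k),
    div_le_iff₀ (by positivity), add_mul, div_mul_cancel₀ _ (by positivity)]
  linarith

/-- The first Weyl averages of the interleaving of a generic sequence with the dyadic phases
diverge. -/
lemma IsGeneric.not_tendsto_weylAverage {z : BinSeq} (hz : IsGeneric z) {p q : ℕ} (hp : 2 ≤ p)
    (hpq : p < q) (c : ℂ) :
    ¬ Tendsto (fun n => weylAverage (interleave p q z dyadicPhase) 1 n) atTop (𝓝 c) := by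
  intro hc
  have hq : 0 < q := by omega
  have hq' : (0 : ℝ) < q := by exact_mod_cast hq
  have him := (Complex.continuous_im.tendsto c).comp hc
  simp only [Function.comp_def, im_weylAverage] at him
  have hlim : Tendsto (fun M : ℕ => 2 * Real.pi / 2 ^ (M + 3)) atTop (𝓝 0) :=
    Tendsto.const_div_atTop ((tendsto_pow_atTop_atTop_of_one_lt one_lt_two).comp
      (tendsto_add_atTop_nat 3)) _
  -- Each truncation error is below half the gap 1/(8q) between the two phase means.
  obtain ⟨M, hM⟩ := (hlim.eventually_lt_const (by positivity : 0 < 1 / (8 * q : ℝ) / 2)).exists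
  have htwo : Tendsto (fun k : ℕ => 2 * k) atTop atTop :=
    tendsto_id.const_mul_atTop' two_pos
  have h0 := hz.abs_sub_phaseMean_le hq (M + 3) (β := 0) htwo
    (fun k => by simp [parityBit]) him
  have h1 := hz.abs_sub_phaseMean_le hq (M + 3) (β := 1) ((tendsto_add_atTop_nat 1).comp htwo)
    (fun k => by simp [parityBit, Nat.add_mod]) him
  have h2 := le_phaseMean_zero hp hpq M
  have h3 := phaseMean_one_nonpos hpq.le M
  rw [abs_le] at h0 h1
  linarith [h0.1, h1.2]

end FSDim

theorem mainTheorem4 (r : ℚ) (hr0 : 0 < r) (hr1 : r < 1) :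
    ∃ x : FSDim.BinSeq,
      FSDim.dimFS x = (r : ℝ) ∧ FSDim.strongDimFS x = (r : ℝ) ∧
      ∃ k : ℤ, ¬ ∃ c : ℂ, Tendsto (fun n : ℕ => FSDim.weylAverage x k n) atTop (𝓝 c) := by
  obtain ⟨z, hz⟩ := FSDim.exists_isGeneric
  have hnum : 0 < r.num := Rat.num_pos.2 hr0
  have hden : 0 < r.den := r.den_pos
  have hlt : r.num < r.den := Rat.num_lt_denom_iff.2 hr1
  obtain ⟨p, q, hp, hpq, hr⟩ : ∃ p q : ℕ, 2 ≤ p ∧ p < q ∧ (r : ℝ) = p / q := by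
    -- Doubling numerator and denominator secures p ≥ 2, even when r has numerator 1.
    refine ⟨2 * r.num.toNat, 2 * r.den, by omega, by omega, ?_⟩
    have h1 : ((r.num.toNat : ℕ) : ℝ) = (r.num : ℝ) := by
      exact_mod_cast congrArg (Int.cast (R := ℝ)) (Int.toNat_of_nonneg hnum.le)
    push_cast
    rw [h1, mul_div_mul_left _ _ two_ne_zero, Rat.cast_def]
  have hq : 0 < q := by omega
  have hlow := hz.le_dimFS_interleave hq hpq.le FSDim.dyadicPhase
  have hup := FSDim.strongDimFS_interleave_le hq hpq.le z
  have hmid := FSDim.dimFS_le_strongDimFS (FSDim.interleave p q z FSDim.dyadicPhase)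
  refine ⟨FSDim.interleave p q z FSDim.dyadicPhase, ?_, ?_, 1, ?_⟩
  · rw [hr]
    exact le_antisymm (hmid.trans hup) hlow
  · rw [hr]
    exact le_antisymm hup (hlow.trans hmid)
  · rintro ⟨c, hc⟩
    exact hz.not_tendsto_weylAverage hp hpq c hc
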